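/- **Theorem 1.7.** Let $D=(V,A)$ be a finite digraph (parallel arcs allowed), and let $\mathcal F$ be a family of subsets of $V$. For $U\subseteq V$ let $\delta^+(U)$ and $\delta^-(U)$ be the sets of arcs leaving and entering $U$, write $\delta^+(u)=\delta^+(\{u\})$, and let $x(J)=\sum_{a\in J}x_a$ for $x\in\mathbb R^A$ and $J\subseteq A$. A *dicut* is a set $\delta^+(U)$ with $\emptyset\ne U\subsetneq V$ and $\delta^-(U)=\emptyset$. Let $$\mathrm{dij}(D)=\{x\in\mathbb R^A: x\ge \mathbf 0,\ x(\delta^+(U))\ge 1 \text{ for every dicut } \delta^+(U)\},$$ $$F(D,\mathcal F)=\mathrm{dij}(D)\cap\{x\in\mathbb R^A: x(\delta^+(U))=1\ \ \forall U\in\mathcal F\}.$$ The pair $(D,\mathcal F)$ is a *digraft* if every node of $D$ is a source (no entering arc) or a sink (no leaving arc), the underlying undirected graph of $D$ is $2$-edge-connected (in particular $V\neq\emptyset$), $\emptyset,V\notin\mathcal F$, $\delta^-(U)=\emptyset$ for every $U\in\mathcal F$, $V\setminus\{v\}\in\mathcal F$ for every sink $v$, and $F(D,\mathcal F)\ne\emptyset$.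 A digraft is *basic* if, whenever $\delta^+(U)$ is a dicut with $F(D,\mathcal F)\subseteq\{x: x(\delta^+(U))=1\}$, then $U\in\mathcal F$ and $|U|\in\{1,|V|-1\}$. A basic digraft is *robust* if every facet-defining inequality for $F(D,\mathcal F)$ is equivalent to (defines the same facet of $F(D,\mathcal F)$ as) $x_a\ge 0$ for some arc $a\in A$, or $x(\delta^+(u))\ge 1$ for some source $u$ of $D$. For $P\subseteq\mathbb R^A$ and an integer $k\ge 1$, let $kP$ be the set of all points $\sum_{p\in P}\lambda_p p$ with $\lambda_p\ge 0$, only finitely many $\lambda_p$ nonzero, and $\sum_{p}\lambda_p=k$. The set $P$ has the *integer decomposition property* if for every integer $k\ge 1$, every integral point of $kP$ is the sum of $k$ (not necessarily distinct) integral points of $P$. Let $(D,\mathcal F)$ be a basic robust digraft. Then $F(D,\mathcal F)$ has the integer decomposition property, and there are an integer $m\ge 1$ and an integer matrix $M\in\mathbb Z^{m\times A}$ such that the affine hull of $F(D,\mathcal F)$ is $\{x\in\mathbb R^A: Mx=\mathbf 1\}$. -/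

import Mathlib

/-- A directed graph with node set `V` and arc set `A`; parallel arcs are allowed. -/
structure MultiDigraph (V A : Type*) where
  tail : A → V
  head : A → V

namespace MultiDigraph

variable {V A : Type*}

/-- No arc enters `v`. -/
def IsSource (D : MultiDigraph V A) (v : V) : Prop := ∀ a, D.head a ≠ v

/-- No arc leaves `v`. -/
def IsSink (D : MultiDigraph V A) (v : V) : Prop := ∀ a, D.tail a ≠ v

/-- Every node is a source or a sink. -/
def IsBipartite (D : MultiDigraph V A) : Prop := ∀ v, D.IsSource v ∨ D.IsSink v

/-- `δ⁺(U)`: the arcs leaving `U`. -/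
def outArcs [DecidableEq V] [Fintype A] (D : MultiDigraph V A) (U : Finset V) : Finset A :=
  Finset.univ.filter fun a => D.tail a ∈ U ∧ D.head a ∉ U

/-- `δ⁻(U)`: the arcs entering `U`. -/
def inArcs [DecidableEq V] [Fintype A] (D : MultiDigraph V A) (U : Finset V) : Finset A :=
  Finset.univ.filter fun a => D.tail a ∉ U ∧ D.head a ∈ U

variable [Fintype V] [DecidableEq V] [Fintype A]

/-- The underlying undirected graph is 2-edge-connected: the node set is nonempty, and at least
two edges have exactly one end in `U`, for every nonempty proper subset `U` of the nodes. -/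
def IsTwoEdgeConnected (D : MultiDigraph V A) : Prop :=
  Nonempty V ∧ ∀ U : Finset V, U.Nonempty → U ≠ Finset.univ →
    2 ≤ (Finset.univ.filter fun a : A => ¬ (D.tail a ∈ U ↔ D.head a ∈ U)).card

/-- `δ⁺(U)` is a dicut: `U` is a nonempty proper subset of the nodes that no arc enters. -/
def IsDicut (D : MultiDigraph V A) (U : Finset V) : Prop :=
  U.Nonempty ∧ U ≠ Finset.univ ∧ D.inArcs U = ∅

/-- The dijoin polyhedron. -/
def dij (D : MultiDigraph V A) : Set (A → ℝ) :=
  {x | (∀ U : Finset V, D.IsDicut U → 1 ≤ ∑ a ∈ D.outArcs U, x a) ∧ ∀ a, 0 ≤ x a}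

/-- `F(D, 𝓕)`: the points of the dijoin polyhedron with `x(δ⁺(U)) = 1` for all `U ∈ 𝓕`. -/
def dijFace (D : MultiDigraph V A) (F : Set (Finset V)) : Set (A → ℝ) :=
  D.dij ∩ {x | ∀ U ∈ F, ∑ a ∈ D.outArcs U, x a = 1}

/-- The pair `(D, 𝓕)` is a digraft. -/
structure IsDigraft (D : MultiDigraph V A) (F : Set (Finset V)) : Prop where
  bipartite : D.IsBipartite
  twoEdgeConnected : D.IsTwoEdgeConnected
  empty_notMem : ∅ ∉ F
  univ_notMem : Finset.univ ∉ F
  inArcs_eq_empty : ∀ U ∈ F, D.inArcs U = ∅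
  compl_sink_mem : ∀ v, D.IsSink v → ({v}ᶜ : Finset V) ∈ F
  dijFace_nonempty : (D.dijFace F).Nonempty

/-- A digraft is basic if every dicut `δ⁺(U)` with `x(δ⁺(U)) = 1` on all of `F(D, 𝓕)`
satisfies `U ∈ 𝓕` and `|U| ∈ {1, |V| - 1}`. -/
structure IsBasicDigraft (D : MultiDigraph V A) (F : Set (Finset V)) : Prop
    extends D.IsDigraft F where
  basic : ∀ U : Finset V, D.IsDicut U →
    (∀ x ∈ D.dijFace F, ∑ a ∈ D.outArcs U, x a = 1) →
      U ∈ F ∧ (U.card = 1 ∨ U.card + 1 = Fintype.card V)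

end MultiDigraph

/-- The points of `P` at which the inequality `c · x ≥ β` holds with equality. -/
def ineqFace {A : Type*} [Fintype A] (P : Set (A → ℝ)) (c : A → ℝ) (β : ℝ) : Set (A → ℝ) :=
  {x | x ∈ P ∧ ∑ a, c a * x a = β}

/-- The inequality `c · x ≥ β` is facet-defining for `P`: it is valid for `P`, and the set of
points of `P` satisfying it with equality is nonempty and has dimension `dim P - 1`. -/
def IsFacetDefining {A : Type*} [Fintype A] (P : Set (A → ℝ)) (c : A → ℝ) (β : ℝ) : Prop :=
  (∀ x ∈ P, β ≤ ∑ a, c a * x a) ∧ (ineqFace P c β).Nonempty ∧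
    Module.finrank ℝ (vectorSpan ℝ (ineqFace P c β)) + 1 = Module.finrank ℝ (vectorSpan ℝ P)

/-- A basic digraft is robust if every facet-defining inequality for `F(D, 𝓕)` is equivalent to
(that is, defines the same facet of `F(D, 𝓕)` as) `x_a ≥ 0` for some arc `a`, or
`x(δ⁺(u)) ≥ 1` for some source `u`. -/
structure MultiDigraph.IsBasicRobustDigraft {V A : Type*} [Fintype V] [DecidableEq V] [Fintype A]
    (D : MultiDigraph V A) (F : Set (Finset V)) : Prop extends D.IsBasicDigraft F where
  robust : ∀ (c : A → ℝ) (β : ℝ), IsFacetDefining (D.dijFace F) c β →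
    (∃ a, ineqFace (D.dijFace F) c β = {x | x ∈ D.dijFace F ∧ x a = 0}) ∨
    (∃ u, D.IsSource u ∧
      ineqFace (D.dijFace F) c β = {x | x ∈ D.dijFace F ∧ ∑ a ∈ D.outArcs {u}, x a = 1})

/-- `kP`: all points `∑ λ_p p` with finitely many `p ∈ P`, `λ ≥ 0` and `∑ λ_p = k`. -/
def multipleOf {A : Type*} (k : ℕ) (P : Set (A → ℝ)) : Set (A → ℝ) :=
  {y | ∃ (s : Finset (A → ℝ)) (w : (A → ℝ) → ℝ), (∀ p ∈ s, p ∈ P) ∧ (∀ p ∈ s, 0 ≤ w p) ∧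
    ∑ p ∈ s, w p = k ∧ y = ∑ p ∈ s, w p • p}

/-- All coordinates are integers. -/
def IsIntegralPoint {A : Type*} (x : A → ℝ) : Prop := ∀ a, ∃ z : ℤ, x a = z

/-- The integer decomposition property. -/
def HasIDP {A : Type*} (P : Set (A → ℝ)) : Prop :=
  ∀ k : ℕ, 1 ≤ k → ∀ y ∈ multipleOf k P, IsIntegralPoint y →
    ∃ p : Fin k → (A → ℝ), (∀ i, p i ∈ P ∧ IsIntegralPoint (p i)) ∧ y = ∑ i, p i

/-! Every point of `D.dijFace F` is nonnegative, has degree one at each sink and at least one at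
each source. Basicness makes every dicut of constant value one a star, and robustness makes every
facet come from nonnegativity or a source. Hence these degree conditions describe the face, once one
adds that arcs vanishing on the whole face get value zero and that sources of constant degree one
keep it (`IsBasicRobustDigraft.mem_dijFace`). The passage from facets to a full description is
`mem_polyhedron_of_forall_facet`.

An integral point of the `k`-fold multiple is therefore a bipartite multigraph with degree `k` at
sinks and at least `k` at sources. Hall's theorem peels off one suitable subgraph at a time
(`exists_spanning_decomposition`). The added equations pass to the summands: nonnegative terms with
sum zero vanish, and `k` integers that are at least one and sum to `k` all equal one.

The affine hull is cut out by the implicit equations, of the form `x(δ⁺(U)) = 1` or `x_a = 0`.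
Adding a sink's equation to the latter turns its right-hand side into one. -/

/-! ### Polyhedra, faces and facets. -/

section Polyhedron

variable {E ι : Type*} [AddCommGroup E] [Module ℝ E]

/-- The polyhedron cut out by the inequalities `β i ≤ ℓ i x` for `i ∈ s` and the equations
`ℓ i x = β i` for `i ∈ T`. -/
def polyhedron (ℓ : ι → E →ₗ[ℝ] ℝ) (β : ι → ℝ) (s : Finset ι) (T : Set ι) : Set E :=
  {x | (∀ i ∈ s, β i ≤ ℓ i x) ∧ ∀ i ∈ T, ℓ i x = β i}

variable {ℓ : ι → E →ₗ[ℝ] ℝ} {β : ι → ℝ}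

/-- A midpoint is strict for every inequality that is strict at one of its two ends. -/
theorem exists_mem_polyhedron_forall_lt {t : Finset ι} {T : Set ι}
    (hne : (polyhedron ℓ β t T).Nonempty) (s : Finset ι)
    (hs : ∀ i ∈ s, ∃ x ∈ polyhedron ℓ β t T, β i < ℓ i x) (hst : s ⊆ t) :
    ∃ z ∈ polyhedron ℓ β t T, ∀ i ∈ s, β i < ℓ i z := by
  classical
  induction s using Finset.induction_on with
  | empty => obtain ⟨z, hz⟩ := hne; exact ⟨z, hz, by simp⟩
  | insert j s hj ih =>
    obtain ⟨z, hz, hzs⟩ := ih (fun i hi => hs i (Finset.mem_insert_of_mem hi))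
      (fun i hi => hst (Finset.mem_insert_of_mem hi))
    obtain ⟨x, hx, hxj⟩ := hs j (Finset.mem_insert_self j s)
    refine ⟨(1 / 2 : ℝ) • z + (1 / 2 : ℝ) • x, ⟨fun i hi => ?_, fun i hi => ?_⟩, fun i hi => ?_⟩
    · have h1 := hz.1 i hi
      have h2 := hx.1 i hi
      simp only [map_add, map_smul, smul_eq_mul]
      linarith
    · have h1 := hz.2 i hi
      have h2 := hx.2 i hi
      simp only [map_add, map_smul, smul_eq_mul]
      linarith
    · simp only [map_add, map_smul, smul_eq_mul]
      have h2 := hx.1 i (hst hi)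
      have h1 := hz.1 i (hst hi)
      rcases Finset.mem_insert.1 hi with rfl | hi
      · linarith
      · have := hzs i hi
        linarith

theorem exists_pos_forall_le_map_add_smul (s : Finset ι) {w : E} (hw : ∀ i ∈ s, β i < ℓ i w)
    (d : E) : ∃ ε : ℝ, 0 < ε ∧ ∀ i ∈ s, β i ≤ ℓ i (w + ε • d) := by
  have h : ∀ᶠ ε in nhdsWithin (0 : ℝ) (Set.Ioi 0), ∀ i ∈ s, β i ≤ ℓ i (w + ε • d) := by
    rw [Filter.eventually_all_finset]
    intro i hi
    have hc : Filter.Tendsto (fun ε : ℝ => ℓ i w + ε * ℓ i d) (nhdsWithin (0 : ℝ) (Set.Ioi 0))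
        (nhds (ℓ i w + 0 * ℓ i d)) :=
      (Continuous.tendsto (by fun_prop) 0).mono_left nhdsWithin_le_nhds
    filter_upwards [hc.eventually (lt_mem_nhds (a := β i) (by simpa using hw i hi))] with ε hε
    simpa using hε.le
  obtain ⟨ε, h1, h2⟩ := (h.and self_mem_nhdsWithin).exists
  exact ⟨ε, h2, h1⟩

/-- The direction space of a polyhedron with a point satisfying all its inequalities strictly. -/
theorem vectorSpan_polyhedron {s : Finset ι} {T : Set ι} {w : E} (hw : w ∈ polyhedron ℓ β s T)
    (hws : ∀ i ∈ s, β i < ℓ i w) :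
    vectorSpan ℝ (polyhedron ℓ β s T) = ⨅ i ∈ T, LinearMap.ker (ℓ i) := by
  apply le_antisymm
  · rw [vectorSpan_def, Submodule.span_le]
    rintro _ ⟨x, hx, y, hy, rfl⟩
    simp only [SetLike.mem_coe, Submodule.mem_iInf, LinearMap.mem_ker, vsub_eq_sub, map_sub]
    intro i hi
    rw [hx.2 i hi, hy.2 i hi, sub_self]
  · intro d hd
    simp only [Submodule.mem_iInf, LinearMap.mem_ker] at hd
    -- Strictness leaves room for a small step along any direction that the equations allow.
    obtain ⟨ε, hε, h⟩ := exists_pos_forall_le_map_add_smul s hws d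
    have hm : w + ε • d ∈ polyhedron ℓ β s T :=
      ⟨h, fun i hi => by simp [hd i hi, hw.2 i hi]⟩
    have h2 := vsub_mem_vectorSpan ℝ hm hw
    rw [vsub_eq_sub, add_sub_cancel_left] at h2
    exact (Submodule.smul_mem_iff _ hε.ne').1 h2

theorem affineSpan_polyhedron {s : Finset ι} {T : Set ι} {w : E} (hw : w ∈ polyhedron ℓ β s T)
    (hws : ∀ i ∈ s, β i < ℓ i w) :
    (affineSpan ℝ (polyhedron ℓ β s T) : Set E) = {x | ∀ i ∈ T, ℓ i x = β i} := by
  ext x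
  rw [SetLike.mem_coe, ← AffineSubspace.vsub_right_mem_direction_iff_mem
    (mem_affineSpan ℝ hw), direction_affineSpan, vectorSpan_polyhedron hw hws]
  simp only [Submodule.mem_iInf, LinearMap.mem_ker, vsub_eq_sub, map_sub, Set.mem_ofPred_eq]
  refine forall₂_congr fun i hi => ?_
  rw [hw.2 i hi, sub_eq_zero]

/-- An irredundant inequality of a polyhedron defines a face of codimension one. -/
theorem vectorSpan_face_of_irredundant [DecidableEq ι] {s : Finset ι} {T : Set ι} {i : ι}
    (hi : i ∈ s) {z x : E}
    (hz : z ∈ polyhedron ℓ β s T) (hzs : ∀ j ∈ s, β j < ℓ j z)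
    (hx : x ∈ polyhedron ℓ β (s.erase i) T) (hxi : ℓ i x < β i) :
    {y | y ∈ polyhedron ℓ β s T ∧ ℓ i y = β i}.Nonempty ∧
      vectorSpan ℝ {y | y ∈ polyhedron ℓ β s T ∧ ℓ i y = β i} =
        (⨅ j ∈ T, LinearMap.ker (ℓ j)) ⊓ LinearMap.ker (ℓ i) := by
  have hface : {y | y ∈ polyhedron ℓ β s T ∧ ℓ i y = β i} =
      polyhedron ℓ β (s.erase i) (insert i T) := by
    ext y
    constructor
    · rintro ⟨h1, h2⟩
      refine ⟨fun j hj => h1.1 j (Finset.mem_of_mem_erase hj), fun j hj => ?_⟩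
      rcases hj with rfl | hj
      · exact h2
      · exact h1.2 j hj
    · rintro ⟨h1, h2⟩
      refine ⟨⟨fun j hj => ?_, fun j hj => h2 j (Or.inr hj)⟩, h2 i (Or.inl rfl)⟩
      by_cases hji : j = i
      · subst hji
        exact (h2 j (Or.inl rfl)).ge
      · exact h1 j (Finset.mem_erase.2 ⟨hji, hj⟩)
  have hzi := hzs i hi
  -- The segment from `z` to `x` meets `ℓ i = β i` at parameter `t`; since `t < 1`, the other
  -- inequalities, strict at `z`, are still strict there.
  set t : ℝ := (ℓ i z - β i) / (ℓ i z - ℓ i x) with ht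
  have hpos : 0 < ℓ i z - ℓ i x := by linarith
  have ht0 : 0 < t := div_pos (by linarith) hpos
  have ht1 : t < 1 := (div_lt_one hpos).2 (by linarith)
  have hw : z + t • (x - z) ∈ polyhedron ℓ β (s.erase i) (insert i T) ∧
      ∀ j ∈ s.erase i, β j < ℓ j (z + t • (x - z)) := by
    have key : ∀ j ∈ s.erase i, β j < ℓ j (z + t • (x - z)) := by
      intro j hj
      have h1 := hzs j (Finset.mem_of_mem_erase hj)
      have h2 := hx.1 j hj
      simp only [map_add, map_smul, map_sub, smul_eq_mul]
      nlinarith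
    refine ⟨⟨fun j hj => (key j hj).le, fun j hj => ?_⟩, key⟩
    simp only [map_add, map_smul, map_sub, smul_eq_mul]
    rcases hj with rfl | hj
    · rw [ht]
      field_simp
      ring
    · rw [hx.2 j hj, hz.2 j hj]
      ring
  rw [hface]
  refine ⟨⟨_, hw.1⟩, ?_⟩
  rw [vectorSpan_polyhedron hw.1 hw.2, iInf_insert, inf_comm]

theorem finrank_inf_ker_add_one [FiniteDimensional ℝ E] (W : Submodule ℝ E) (f : E →ₗ[ℝ] ℝ)
    {d : E} (hd : d ∈ W) (hfd : f d ≠ 0) :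
    Module.finrank ℝ (W ⊓ LinearMap.ker f : Submodule ℝ E) + 1 = Module.finrank ℝ W := by
  have h : f.domRestrict W ≠ 0 := fun h0 => hfd (by simpa using LinearMap.congr_fun h0 ⟨d, hd⟩)
  rw [← Module.Dual.finrank_ker_add_one_of_ne_zero (f := f.domRestrict W) h]
  have hmap : W ⊓ LinearMap.ker f =
      (LinearMap.ker (f.domRestrict W)).map W.subtype := by
    ext x
    simp [LinearMap.domRestrict_apply, and_comm]
  rw [hmap, Submodule.finrank_map_subtype_eq]

/-- In a minimal subsystem each inequality is irredundant, hence defines a facet. On the solutions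
of the equations, two inequalities defining the same facet differ by a positive factor, so `ℓ i` may
be replaced by `f`. -/
theorem mem_polyhedron_of_forall_facet [FiniteDimensional ℝ E] [DecidableEq ι]
    {s : Finset ι} {T : Set ι} (hne : (polyhedron ℓ β s T).Nonempty)
    (hT : ∀ i ∈ s, (∀ x ∈ polyhedron ℓ β s T, ℓ i x = β i) → i ∈ T)
    {x : E} (hxT : ∀ i ∈ T, ℓ i x = β i)
    (hx : ∀ i ∈ s, {y | y ∈ polyhedron ℓ β s T ∧ ℓ i y = β i}.Nonempty →
      Module.finrank ℝ (vectorSpan ℝ {y | y ∈ polyhedron ℓ β s T ∧ ℓ i y = β i}) + 1 =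
        Module.finrank ℝ (vectorSpan ℝ (polyhedron ℓ β s T)) →
      ∃ (f : E →ₗ[ℝ] ℝ) (b : ℝ), (∀ y ∈ polyhedron ℓ β s T, b ≤ f y) ∧
        {y | y ∈ polyhedron ℓ β s T ∧ ℓ i y = β i} = {y | y ∈ polyhedron ℓ β s T ∧ f y = b} ∧
        b ≤ f x) :
    x ∈ polyhedron ℓ β s T := by
  obtain ⟨r, hr, hmin⟩ : ∃ r : Finset ι, (r ⊆ s ∧ polyhedron ℓ β r T = polyhedron ℓ β s T) ∧
      ∀ r', r' ⊂ r → ¬ (r' ⊆ s ∧ polyhedron ℓ β r' T = polyhedron ℓ β s T) := by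
    have hfin : {r | r ⊆ s ∧ polyhedron ℓ β r T = polyhedron ℓ β s T}.Finite :=
      s.powerset.finite_toSet.subset fun r hr => by simpa using hr.1
    obtain ⟨r, hr⟩ := hfin.exists_minimal ⟨s, subset_rfl, rfl⟩
    exact ⟨r, hr.1, fun r' h h' => h.2 (hr.2 h' h.1)⟩
  obtain ⟨hrs, hrP⟩ := hr
  have hirr : ∀ i ∈ r, ∃ v ∈ polyhedron ℓ β (r.erase i) T, ℓ i v < β i := by
    intro i hi
    by_contra! hcon
    refine hmin _ (Finset.erase_ssubset hi) ⟨(Finset.erase_subset _ _).trans hrs, ?_⟩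
    rw [← hrP]
    refine Set.Subset.antisymm (fun v hv => ⟨fun j hj => ?_, hv.2⟩)
      fun v hv => ⟨fun j hj => hv.1 j (Finset.mem_of_mem_erase hj), hv.2⟩
    by_cases hji : j = i
    · exact hji ▸ hcon v hv
    · exact hv.1 j (Finset.mem_erase.2 ⟨hji, hj⟩)
  have hrT : ∀ i ∈ r, i ∉ T := by
    intro i hi hiT
    obtain ⟨v, hv, hlt⟩ := hirr i hi
    exact hlt.ne (hv.2 i hiT)
  rw [← hrP] at hne hT hx ⊢
  obtain ⟨z, hz, hzr⟩ := exists_mem_polyhedron_forall_lt hne r (fun i hi => by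
    by_contra! hcon
    exact hrT i hi (hT i (hrs hi) fun v hv => le_antisymm (hcon v hv) (hv.1 i hi))) subset_rfl
  refine ⟨fun i hi => ?_, hxT⟩
  obtain ⟨v, hv, hvi⟩ := hirr i hi
  obtain ⟨hGne, hG⟩ := vectorSpan_face_of_irredundant hi hz hzr hv hvi
  have hW := vectorSpan_polyhedron hz hzr
  have hzi := hzr i hi
  obtain ⟨f, b, hf, hfG, hfx⟩ := hx i (hrs hi) hGne (by
    rw [hG, hW]
    refine finrank_inf_ker_add_one _ _ (d := v - z) ?_ ?_
    · simp only [Submodule.mem_iInf, LinearMap.mem_ker, map_sub]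
      intro j hj
      rw [hv.2 j hj, hz.2 j hj, sub_self]
    · rw [map_sub]
      linarith)
  obtain ⟨g, hg⟩ := hGne
  have hgf : f g = b := (hfG.subset hg).2
  have hzb : b < f z := lt_of_le_of_ne (hf z hz) fun h =>
    hzi.ne' ((hfG.symm.subset ⟨hz, h.symm⟩ : z ∈ {y | _}).2)
  have hpos : 0 < ℓ i z - ℓ i g := by rw [hg.2]; linarith
  -- With this `t`, the vector `(x - g) - t • (z - g)` is parallel to the facet, where `f` is
  -- constant. So `f x - b = t * (f z - b)`, which forces `t ≥ 0`.
  set t : ℝ := (ℓ i x - ℓ i g) / (ℓ i z - ℓ i g) with ht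
  have hd : (x - g) - t • (z - g) ∈
      vectorSpan ℝ {y | y ∈ polyhedron ℓ β r T ∧ ℓ i y = β i} := by
    rw [hG]
    simp only [Submodule.mem_inf, Submodule.mem_iInf, LinearMap.mem_ker, map_sub, map_smul,
      smul_eq_mul]
    refine ⟨fun j hj => ?_, ?_⟩
    · rw [hxT j hj, hg.1.2 j hj, hz.2 j hj]
      ring
    · rw [ht]
      field_simp
      ring
  have hker : vectorSpan ℝ {y | y ∈ polyhedron ℓ β r T ∧ ℓ i y = β i} ≤ LinearMap.ker f := by
    rw [hfG, vectorSpan_def, Submodule.span_le]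
    rintro _ ⟨p, hp, q, hq, rfl⟩
    simp [hp.2, hq.2]
  have hfd := hker hd
  simp only [LinearMap.mem_ker, map_sub, map_smul, smul_eq_mul, hgf] at hfd
  have ht0 : 0 ≤ t := by
    by_contra! hneg
    nlinarith
  have h2 : ℓ i x - ℓ i g = t * (ℓ i z - ℓ i g) := by
    rw [ht]
    field_simp
  have h3 := mul_nonneg ht0 hpos.le
  have h4 := hg.2
  linarith

end Polyhedron

/-! ### Decomposition of bipartite multigraphs. -/

section Decomposition

variable {A S R : Type*} [Fintype A] [Fintype S] [Fintype R] [DecidableEq S] [DecidableEq R]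

/-- The inductive step of `exists_spanning_decomposition`, by Hall's theorem: the rows are the nodes
of `R` and some dummies; the columns are one essential slot, which no dummy may take, and `e u`
optional slots for each node `u` of `S`. -/
theorem exists_spanning_summand (σ : A → S) (τ : A → R) (k : ℕ) (y : A → ℕ)
    (hin : ∀ r, ∑ a with τ a = r, y a = k + 1) (hout : ∀ u, k + 1 ≤ ∑ a with σ a = u, y a) :
    ∃ p : A → ℕ, (∀ a, p a ≤ y a) ∧ (∀ r, ∑ a with τ a = r, p a = 1) ∧
      (∀ u, 1 ≤ ∑ a with σ a = u, p a) ∧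
      ∀ u, ∑ a with σ a = u, p a + k ≤ ∑ a with σ a = u, y a := by
  classical
  choose e he using fun u => Nat.exists_eq_add_of_le (hout u)
  have htot : (k + 1) * Fintype.card R = (k + 1) * Fintype.card S + ∑ u, e u := by
    have h1 : ∑ r, ∑ a with τ a = r, y a = ∑ a, y a := Finset.sum_fiberwise _ _ _
    have h2 : ∑ u, ∑ a with σ a = u, y a = ∑ a, y a := Finset.sum_fiberwise _ _ _
    simp only [hin, Finset.sum_const, Finset.card_univ, smul_eq_mul] at h1
    simp only [he, Finset.sum_add_distrib, Finset.sum_const, Finset.card_univ, smul_eq_mul] at h2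
    rw [← h2] at h1
    linarith
  obtain ⟨q, hq⟩ : ∃ q, Fintype.card R = Fintype.card S + q :=
    Nat.exists_eq_add_of_le (Nat.le_of_mul_le_mul_left
      (htot ▸ Nat.le_add_right _ _) (Nat.succ_pos k))
  have hesum : ∑ u, e u = (k + 1) * q := by
    rw [hq, mul_add] at htot
    omega
  -- As `q = |R| - |S|` and the excesses `e u` sum to `(k + 1) * q`, exactly `k * q` dummies make
  -- rows and columns equinumerous.
  let adj : R ⊕ Fin (k * q) → Finset (S ⊕ (Σ u : S, Fin (e u))) :=
    Sum.elim
      (fun r => Finset.disjSum (Finset.univ.filter fun u => ∃ a, τ a = r ∧ σ a = u ∧ 0 < y a)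
        ((Finset.univ.filter fun u => ∃ a, τ a = r ∧ σ a = u ∧ 0 < y a).sigma fun _ => Finset.univ))
      fun _ => Finset.disjSum ∅ Finset.univ
  have hall : ∀ X : Finset (R ⊕ Fin (k * q)), X.card ≤ (X.biUnion adj).card := by
    intro X
    set Y := X.toLeft with hY
    set W : Finset S := Finset.univ.filter fun u => ∃ a, τ a ∈ Y ∧ σ a = u ∧ 0 < y a with hW
    have hXc : X.card = Y.card + X.toRight.card := (Finset.card_toLeft_add_card_toRight).symm
    have hWadj : W.disjSum (W.sigma fun _ => Finset.univ) ⊆ X.biUnion adj := by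
      intro c hc
      rw [Finset.mem_biUnion]
      rcases c with u | ⟨u, j⟩
      · have hu : u ∈ W := by simpa using hc
        obtain ⟨a, h1, h2, h3⟩ := (Finset.mem_filter.1 hu).2
        exact ⟨Sum.inl (τ a), by simpa [hY] using h1, by simpa [adj] using ⟨a, rfl, h2, h3⟩⟩
      · have hu : u ∈ W := by simpa using hc
        obtain ⟨a, h1, h2, h3⟩ := (Finset.mem_filter.1 hu).2
        exact ⟨Sum.inl (τ a), by simpa [hY] using h1, by simpa [adj] using ⟨a, rfl, h2, h3⟩⟩
    have sumτ (Z : Finset R) : ∑ a with τ a ∈ Z, y a = (k + 1) * Z.card := by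
      rw [← Finset.sum_fiberwise_of_maps_to (t := Z) (g := τ) (by simp)]
      rw [Finset.sum_congr rfl (g := fun _ => k + 1), Finset.sum_const, smul_eq_mul, mul_comm]
      intro r hr
      rw [← hin r, Finset.filter_filter]
      refine Finset.sum_congr (Finset.filter_congr fun a _ => ?_) fun _ _ => rfl
      exact ⟨fun h => h.2, fun h => ⟨h ▸ hr, h⟩⟩
    have sumσ (Z : Finset S) :
        ∑ a with σ a ∈ Z, y a = (k + 1) * Z.card + ∑ u ∈ Z, e u := by
      rw [← Finset.sum_fiberwise_of_maps_to (t := Z) (g := σ) (by simp)]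
      rw [Finset.sum_congr rfl (g := fun u => (k + 1) + e u), Finset.sum_add_distrib,
        Finset.sum_const, smul_eq_mul, mul_comm]
      intro r hr
      rw [← he r, Finset.filter_filter]
      refine Finset.sum_congr (Finset.filter_congr fun a _ => ?_) fun _ _ => rfl
      exact ⟨fun h => h.2, fun h => ⟨h ▸ hr, h⟩⟩
    have hmono {Z Z' : A → Prop} [DecidablePred Z] [DecidablePred Z']
        (h : ∀ a, Z a → 0 < y a → Z' a) :
        ∑ a with Z a, y a ≤ ∑ a with Z' a, y a := by
      rw [Finset.sum_filter, Finset.sum_filter]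
      refine Finset.sum_le_sum fun a _ => ?_
      by_cases h1 : Z a
      · by_cases h2 : 0 < y a
        · simp [h1, h a h1 h2]
        · have : y a = 0 := by omega
          simp [this]
      · simp [h1]
    rcases X.toRight.eq_empty_or_nonempty with hR | ⟨j, hj⟩
    · refine le_trans ?_ (Finset.card_le_card hWadj)
      rw [hXc, hR, Finset.card_disjSum, Finset.card_sigma]
      simp only [Finset.card_univ, Fintype.card_fin, Finset.card_empty, add_zero]
      -- Without dummies: all edges at `Y` end in `W`, so `(k + 1)|Y|` is at most the degree sum of
      -- `W`.
      have h := hmono (Z := fun a => τ a ∈ Y) (Z' := fun a => σ a ∈ W) fun a h1 h2 => by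
        simpa [hW] using ⟨a, h1, rfl, h2⟩
      rw [sumτ, sumσ] at h
      refine Nat.le_of_mul_le_mul_left (h.trans ?_) (Nat.succ_pos k)
      rw [mul_add]
      exact Nat.add_le_add_left (Nat.le_mul_of_pos_left _ (Nat.succ_pos k)) _
    · have hsub : W.disjSum Finset.univ ⊆ X.biUnion adj := by
        intro c hc
        rcases c with u | c
        · exact hWadj (by simpa using hc)
        · exact Finset.mem_biUnion.2 ⟨Sum.inr j, by simpa using hj, by simp [adj]⟩
      refine le_trans ?_ (Finset.card_le_card hsub)
      rw [hXc, Finset.card_disjSum, Finset.card_univ, Fintype.card_sigma]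
      simp only [Fintype.card_fin]
      -- With a dummy, every optional slot is a neighbour. It remains to see `|Wᶜ| ≤ |Yᶜ|`, which
      -- follows by counting the edges at `Wᶜ`, all of which end in `Yᶜ`.
      have h := hmono (Z := fun a => σ a ∈ Wᶜ) (Z' := fun a => τ a ∈ Yᶜ) fun a h1 h2 => by
        rw [Finset.mem_compl] at h1 ⊢
        exact fun h3 => h1 (by simpa [hW] using ⟨a, h3, rfl, h2⟩)
      rw [sumτ, sumσ] at h
      have h1 : (Wᶜ).card ≤ (Yᶜ).card :=
        Nat.le_of_mul_le_mul_left ((Nat.le_add_right _ _).trans h) (Nat.succ_pos k)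
      have h2 := Finset.card_compl_add_card W
      have h3 := Finset.card_compl_add_card Y
      have h4 : X.toRight.card ≤ k * q := by simpa using Finset.card_le_univ X.toRight
      rw [hesum, add_mul]
      omega
  obtain ⟨f, hf, hfadj⟩ := (Finset.all_card_le_biUnion_card_iff_exists_injective adj).1 hall
  have hbij : Function.Bijective f := by
    rw [Fintype.bijective_iff_injective_and_card]
    refine ⟨hf, ?_⟩
    simp only [Fintype.card_sum, Fintype.card_fin, Fintype.card_sigma]
    rw [hesum, hq]
    ring
  let g : R → S := fun r => Sum.elim id Sigma.fst (f (Sum.inl r))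
  have hg : ∀ r, ∃ a, τ a = r ∧ σ a = g r ∧ 0 < y a := by
    intro r
    have h := hfadj (Sum.inl r)
    rcases hfr : f (Sum.inl r) with u | ⟨u, j⟩
    · simpa [adj, hfr, g] using h
    · simpa [adj, hfr, g] using h
  choose b hbτ hbσ hby using hg
  have hsumσ : ∀ u, ∑ a with σ a = u, (if b (τ a) = a then 1 else 0) =
      (Finset.univ.filter fun r => g r = u).card := by
    intro u
    rw [Finset.sum_boole, Finset.filter_filter, Nat.cast_id]
    refine Finset.card_bij' (fun a _ => τ a) (fun r _ => b r) ?_ ?_ ?_ ?_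
    · intro a ha
      simp only [Finset.mem_filter, Finset.mem_univ, true_and] at ha ⊢
      rw [← hbσ, ha.2, ha.1]
    · intro r hr
      simp only [Finset.mem_filter, Finset.mem_univ, true_and] at hr ⊢
      rw [hbσ, hbτ]
      exact ⟨hr, rfl⟩
    · intro a ha
      exact (Finset.mem_filter.1 ha).2.2
    · intro r hr
      exact hbτ r
  refine ⟨fun a => if b (τ a) = a then 1 else 0, fun a => ?_, fun r => ?_, fun u => ?_,
    fun u => ?_⟩
  · by_cases h : b (τ a) = a
    · have := hby (τ a)
      rw [h] at this
      simpa [h, Nat.one_le_iff_ne_zero, Nat.pos_iff_ne_zero] using this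
    · simp [h]
  · rw [Finset.sum_eq_single_of_mem (b r) (by simp [hbτ])]
    · simp [hbτ]
    · intro a ha hne
      have : τ a = r := by simpa using ha
      rw [this, if_neg hne.symm]
  · rw [hsumσ, Nat.one_le_iff_ne_zero, Finset.card_ne_zero]
    -- The matching is perfect, and no dummy can fill the essential slot of `u`.
    obtain ⟨c, hc⟩ := hbij.2 (Sum.inl u)
    rcases c with r | j
    · exact ⟨r, by simp [g, hc]⟩
    · have := hfadj (Sum.inr j)
      rw [hc] at this
      simp [adj] at this
  · rw [hsumσ, he]
    -- Only `1 + e u` slots belong to `u`, so removing `p` leaves degree at least `k`.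
    have hcard : (Finset.univ.filter fun r => g r = u).card ≤
        (Finset.disjSum {u} (({u} : Finset S).sigma fun u =>
          (Finset.univ : Finset (Fin (e u))))).card := by
      refine Finset.card_le_card_of_injOn (fun r => f (Sum.inl r)) ?_
        fun r _ r' _ h => Sum.inl_injective (hf h)
      intro r hr
      have hr' : g r = u := by simpa using hr
      rcases hfr : f (Sum.inl r) with v | ⟨v, j⟩
      · simpa [hfr, g] using hr'
      · simpa [hfr, g] using hr'
    rw [Finset.card_disjSum, Finset.card_sigma] at hcard
    simp only [Finset.card_singleton, Finset.sum_singleton, Finset.card_univ,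
      Fintype.card_fin] at hcard
    omega

/-- If every node of `R` has degree `k` and every node of `S` has degree at least `k` in a bipartite
multigraph, then its edges decompose into `k` spanning sets in each of which every node of `R` has
degree one and no node of `S` is isolated. -/
theorem exists_spanning_decomposition (σ : A → S) (τ : A → R) (k : ℕ) (y : A → ℕ)
    (hin : ∀ r, ∑ a with τ a = r, y a = k) (hout : ∀ u, k ≤ ∑ a with σ a = u, y a) :
    ∃ p : Fin k → A → ℕ, (∀ a, y a = ∑ i, p i a) ∧
      ∀ i, (∀ r, ∑ a with τ a = r, p i a = 1) ∧ ∀ u, 1 ≤ ∑ a with σ a = u, p i a := by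
  induction k generalizing y with
  | zero =>
    refine ⟨Fin.elim0, fun a => ?_, fun i => i.elim0⟩
    have := Finset.sum_eq_zero_iff.1 (hin (τ a)) a (by simp)
    simpa using this
  | succ k ih =>
    obtain ⟨p, hpy, hpτ, hpσ, hpk⟩ := exists_spanning_summand σ τ k y hin hout
    have hsplit (Z : Finset A) : ∑ a ∈ Z, (y a - p a) + ∑ a ∈ Z, p a = ∑ a ∈ Z, y a := by
      rw [← Finset.sum_add_distrib]
      exact Finset.sum_congr rfl fun a _ => Nat.sub_add_cancel (hpy a)
    obtain ⟨p', hp'y, hp'⟩ := ih (fun a => y a - p a)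
      (fun r => by
        have h1 := hsplit (Finset.univ.filter fun a => τ a = r)
        have h2 := hin r
        have h3 := hpτ r
        omega)
      (fun u => by
        have h1 := hsplit (Finset.univ.filter fun a => σ a = u)
        have h2 := hpk u
        omega)
    refine ⟨Fin.cons p p', fun a => ?_, fun i => ?_⟩
    · rw [Fin.sum_univ_succ]
      simp only [Fin.cons_zero, Fin.cons_succ]
      have := hp'y a
      have := hpy a
      omega
    · refine Fin.cases ?_ (fun i => ?_) i
      · simpa using ⟨hpτ, hpσ⟩
      · simpa using hp' i

end Decomposition

/-! ### Coordinate sums on multiples of a set. -/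

/-- The linear form `x ↦ x(J)`. -/
def sumForm {A : Type*} (J : Finset A) : (A → ℝ) →ₗ[ℝ] ℝ := ∑ a ∈ J, LinearMap.proj a

@[simp]
theorem sumForm_apply {A : Type*} (J : Finset A) (x : A → ℝ) : sumForm J x = ∑ a ∈ J, x a := by
  simp [sumForm]

theorem le_sum_of_mem_multipleOf {A : Type*} {k : ℕ} {P : Set (A → ℝ)} {y : A → ℝ}
    (hy : y ∈ multipleOf k P) {J : Finset A} {b : ℝ} (hP : ∀ x ∈ P, b ≤ ∑ a ∈ J, x a) :
    k * b ≤ ∑ a ∈ J, y a := by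
  obtain ⟨s, w, hs, hw, hk, rfl⟩ := hy
  have h1 : ∑ a ∈ J, (∑ p ∈ s, w p • p) a = ∑ p ∈ s, w p * ∑ a ∈ J, p a := by
    simp only [Finset.sum_apply, Pi.smul_apply, smul_eq_mul, Finset.mul_sum]
    exact Finset.sum_comm
  rw [h1, ← hk, Finset.sum_mul]
  exact Finset.sum_le_sum fun p hp => mul_le_mul_of_nonneg_left (hP p (hs p hp)) (hw p hp)

theorem sum_eq_of_mem_multipleOf {A : Type*} {k : ℕ} {P : Set (A → ℝ)} {y : A → ℝ}
    (hy : y ∈ multipleOf k P) {J : Finset A} {b : ℝ} (hP : ∀ x ∈ P, ∑ a ∈ J, x a = b) :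
    ∑ a ∈ J, y a = k * b := by
  obtain ⟨s, w, hs, hw, hk, rfl⟩ := hy
  have h1 : ∑ a ∈ J, (∑ p ∈ s, w p • p) a = ∑ p ∈ s, w p * ∑ a ∈ J, p a := by
    simp only [Finset.sum_apply, Pi.smul_apply, smul_eq_mul, Finset.mul_sum]
    exact Finset.sum_comm
  rw [h1, ← hk, Finset.sum_mul]
  exact Finset.sum_congr rfl fun p hp => by rw [hP p (hs p hp)]

/-! ### Degree description of the face. -/

namespace MultiDigraph

variable {V A : Type*} [DecidableEq V] [Fintype A]

theorem outArcs_singleton_of_isSource {D : MultiDigraph V A} {u : V} (hu : D.IsSource u) :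
    D.outArcs {u} = Finset.univ.filter fun a => D.tail a = u := by
  ext a
  simp [outArcs, hu a]

variable [Fintype V]

theorem outArcs_compl_of_isSink {D : MultiDigraph V A} {v : V} (hv : D.IsSink v) :
    D.outArcs {v}ᶜ = Finset.univ.filter fun a => D.head a = v := by
  ext a
  simp [outArcs, hv a]

/-- The index set of the inequalities describing the dijoin polyhedron. -/
noncomputable def dijIndex (D : MultiDigraph V A) : Finset (Finset V ⊕ A) := by
  classical exact (Finset.univ.filter D.IsDicut).disjSum Finset.univ

/-- The left-hand sides of the inequalities describing the dijoin polyhedron. -/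
def dijForm (D : MultiDigraph V A) : Finset V ⊕ A → (A → ℝ) →ₗ[ℝ] ℝ :=
  Sum.elim (fun U => sumForm (D.outArcs U)) fun a => LinearMap.proj a

/-- The right-hand sides of the inequalities describing the dijoin polyhedron. -/
def dijBound {V A : Type*} : Finset V ⊕ A → ℝ := Sum.elim (fun _ => 1) fun _ => 0

/-- The inequalities describing the dijoin polyhedron that hold with equality on `F(D, 𝓕)`. -/
def tightIndex (D : MultiDigraph V A) (F : Set (Finset V)) : Set (Finset V ⊕ A) :=
  {i | i ∈ D.dijIndex ∧ ∀ x ∈ D.dijFace F, D.dijForm i x = dijBound i}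

theorem mem_tightIndex {D : MultiDigraph V A} {F : Set (Finset V)} {i : Finset V ⊕ A} :
    i ∈ D.tightIndex F ↔ i ∈ D.dijIndex ∧ ∀ x ∈ D.dijFace F, D.dijForm i x = dijBound i :=
  Iff.rfl

theorem inl_mem_tightIndex {D : MultiDigraph V A} {F : Set (Finset V)} {U : Finset V} :
    Sum.inl U ∈ D.tightIndex F ↔
      D.IsDicut U ∧ ∀ x ∈ D.dijFace F, ∑ a ∈ D.outArcs U, x a = 1 := by
  simp [tightIndex, dijIndex, dijForm, dijBound]

theorem inr_mem_tightIndex {D : MultiDigraph V A} {F : Set (Finset V)} {a : A} :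
    Sum.inr a ∈ D.tightIndex F ↔ ∀ x ∈ D.dijFace F, x a = 0 := by
  simp [tightIndex, dijIndex, dijForm, dijBound]

theorem forall_mem_tightIndex_iff {D : MultiDigraph V A} {F : Set (Finset V)} {x : A → ℝ} :
    (∀ i ∈ D.tightIndex F, D.dijForm i x = dijBound i) ↔
      (∀ U, Sum.inl U ∈ D.tightIndex F → ∑ a ∈ D.outArcs U, x a = 1) ∧
        ∀ a, Sum.inr a ∈ D.tightIndex F → x a = 0 := by
  simp [dijForm, dijBound]

theorem dijFace_eq_polyhedron {D : MultiDigraph V A} {F : Set (Finset V)}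
    (hF : ∀ U ∈ F, D.IsDicut U) :
    D.dijFace F = polyhedron D.dijForm dijBound D.dijIndex (D.tightIndex F) := by
  apply Set.Subset.antisymm
  · intro x hx
    refine ⟨?_, fun i hi => hi.2 x hx⟩
    rintro (U | a) hi
    · simpa [dijForm, dijBound] using hx.1.1 U (by simpa [dijIndex] using hi)
    · simpa [dijForm, dijBound] using hx.1.2 a
  · intro x hx
    refine ⟨⟨fun U hU => ?_, fun a => ?_⟩, fun U hU => ?_⟩
    · simpa [dijForm, dijBound] using hx.1 (Sum.inl U) (by simpa [dijIndex] using hU)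
    · simpa [dijForm, dijBound] using hx.1 (Sum.inr a) (by simp [dijIndex])
    · simpa [dijForm, dijBound] using hx.2 (Sum.inl U)
        (inl_mem_tightIndex.2 ⟨hF U hU, fun y hy => hy.2 U hU⟩)

variable {D : MultiDigraph V A} {F : Set (Finset V)}

theorem IsDigraft.isDicut (h : D.IsDigraft F) {U : Finset V} (hU : U ∈ F) : D.IsDicut U :=
  ⟨Finset.nonempty_iff_ne_empty.2 fun h0 => h.empty_notMem (h0 ▸ hU),
    fun h0 => h.univ_notMem (h0 ▸ hU), h.inArcs_eq_empty U hU⟩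

theorem IsDigraft.isDicut_singleton (h : D.IsDigraft F) {u : V} (hu : D.IsSource u) :
    D.IsDicut {u} := by
  refine ⟨Finset.singleton_nonempty u, fun h0 => ?_, ?_⟩
  · have hall : ∀ v, v = u := fun v => by simpa using h0.symm.subset (Finset.mem_univ v)
    -- A source that is the only node has no arcs, so it is also a sink, and its complement `∅`
    -- would lie in `F`.
    have := h.compl_sink_mem u fun a => absurd (hall _) (hu a)
    rw [h0, Finset.compl_univ] at this
    exact h.empty_notMem this
  · simp [inArcs, hu _]

theorem IsDigraft.isSink_head (h : D.IsDigraft F) (a : A) : D.IsSink (D.head a) :=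
  (h.bipartite _).resolve_left fun hs => hs a rfl

theorem IsDigraft.isSource_tail (h : D.IsDigraft F) (a : A) : D.IsSource (D.tail a) :=
  (h.bipartite _).resolve_right fun hs => hs a rfl

theorem IsDigraft.exists_isSink (h : D.IsDigraft F) : ∃ v, D.IsSink v := by
  obtain ⟨v⟩ := h.twoEdgeConnected.1
  by_contra! hno
  have hv := (h.bipartite v).resolve_right (hno v)
  have := hno v
  simp only [IsSink, not_forall, not_not] at this
  obtain ⟨a, -⟩ := this
  exact hno _ (h.isSink_head a)

/-- The dicuts of constant value on the face of a basic digraft are stars. -/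
theorem IsBasicDigraft.eq_singleton_or_eq_compl (h : D.IsBasicDigraft F) {U : Finset V}
    (hU : Sum.inl U ∈ D.tightIndex F) :
    (∃ u, D.IsSource u ∧ U = {u}) ∨ ∃ v, D.IsSink v ∧ U = {v}ᶜ := by
  obtain ⟨hd, ht⟩ := inl_mem_tightIndex.1 hU
  have hin : ∀ a, ¬ (D.tail a ∉ U ∧ D.head a ∈ U) := by
    have := hd.2.2
    simpa [inArcs, Finset.filter_eq_empty_iff] using this
  rcases (h.basic U hd ht).2 with hc | hc
  · obtain ⟨u, rfl⟩ := Finset.card_eq_one.1 hc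
    refine Or.inl ⟨u, fun a ha => ?_, rfl⟩
    -- An arc entering `u` from inside `{u}` would be a loop, but tails are sources.
    refine hin a ⟨fun hta => ?_, by simp [ha]⟩
    rw [Finset.mem_singleton] at hta
    exact h.isSource_tail a a (ha.trans hta.symm)
  · obtain ⟨v, hv⟩ := Finset.card_eq_one.1
      (show (Uᶜ).card = 1 by rw [Finset.card_compl]; omega)
    obtain rfl : U = {v}ᶜ := by rw [← hv, compl_compl]
    refine Or.inr ⟨v, fun a ha => ?_, rfl⟩
    refine hin a ⟨by simp [ha], ?_⟩
    simp only [Finset.mem_compl, Finset.mem_singleton]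
    exact fun hh => h.isSource_tail a a (hh.trans ha.symm)

theorem IsBasicDigraft.forall_mem_tightIndex (h : D.IsBasicDigraft F) {x : A → ℝ}
    (hzero : ∀ a, (∀ z ∈ D.dijFace F, z a = 0) → x a = 0)
    (hsink : ∀ v, D.IsSink v → ∑ a ∈ D.outArcs {v}ᶜ, x a = 1)
    (htight : ∀ u, D.IsSource u → (∀ z ∈ D.dijFace F, ∑ a ∈ D.outArcs {u}, z a = 1) →
      ∑ a ∈ D.outArcs {u}, x a = 1) :
    ∀ i ∈ D.tightIndex F, D.dijForm i x = dijBound i := by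
  refine forall_mem_tightIndex_iff.2 ⟨fun U hU => ?_, fun a ha => hzero a (inr_mem_tightIndex.1 ha)⟩
  rcases h.eq_singleton_or_eq_compl hU with ⟨u, hu, rfl⟩ | ⟨v, hv, rfl⟩
  · exact htight u hu (inl_mem_tightIndex.1 hU).2
  · exact hsink v hv

/-- The face of a basic robust digraft is described by degree constraints. -/
theorem IsBasicRobustDigraft.mem_dijFace (h : D.IsBasicRobustDigraft F) {x : A → ℝ}
    (hnonneg : ∀ a, 0 ≤ x a) (hzero : ∀ a, (∀ z ∈ D.dijFace F, z a = 0) → x a = 0)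
    (hsink : ∀ v, D.IsSink v → ∑ a ∈ D.outArcs {v}ᶜ, x a = 1)
    (hsource : ∀ u, D.IsSource u → 1 ≤ ∑ a ∈ D.outArcs {u}, x a)
    (htight : ∀ u, D.IsSource u → (∀ z ∈ D.dijFace F, ∑ a ∈ D.outArcs {u}, z a = 1) →
      ∑ a ∈ D.outArcs {u}, x a = 1) : x ∈ D.dijFace F := by
  classical
  have hP := dijFace_eq_polyhedron (D := D) (F := F) fun U hU => h.isDicut hU
  have hT := h.forall_mem_tightIndex hzero hsink htight
  rw [hP]
  refine mem_polyhedron_of_forall_facet (hP ▸ h.dijFace_nonempty)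
    (fun i hi hi' => mem_tightIndex.2 ⟨hi, by rwa [hP]⟩) hT ?_
  rw [← hP]
  intro i hi hne hdim
  obtain ⟨c, hc⟩ : ∃ c : A → ℝ, ∀ y, D.dijForm i y = ∑ a, c a * y a := by
    rcases i with U | a
    · exact ⟨fun a => if a ∈ D.outArcs U then 1 else 0, fun y => by simp [dijForm]⟩
    · exact ⟨fun b => if b = a then 1 else 0, fun y => by simp [dijForm]⟩
  have hface : {y | y ∈ D.dijFace F ∧ D.dijForm i y = dijBound i} =
      ineqFace (D.dijFace F) c (dijBound i) := by
    ext y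
    simp [ineqFace, hc]
  rw [hface] at hne hdim ⊢
  have hvalid : ∀ y ∈ D.dijFace F, dijBound i ≤ ∑ a, c a * y a := by
    intro y hy
    rw [← hc]
    rw [hP] at hy
    exact hy.1 i hi
  rcases h.robust c _ ⟨hvalid, hne, hdim⟩ with ⟨a, ha⟩ | ⟨u, hu, hu'⟩
  · exact ⟨LinearMap.proj a, 0, fun y hy => hy.1.2 a, ha, hnonneg a⟩
  · exact ⟨sumForm (D.outArcs {u}), 1,
      fun y hy => by simpa using hy.1.1 _ (h.isDicut_singleton hu), by simpa using hu',
      by simpa using hsource u hu⟩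

/-! ### Integer decomposition. -/

theorem IsBasicRobustDigraft.hasIDP (h : D.IsBasicRobustDigraft F) : HasIDP (D.dijFace F) := by
  intro k hk y hy hyint
  have hnn : ∀ a, 0 ≤ y a := fun a => by
    simpa using le_sum_of_mem_multipleOf hy (J := {a}) (b := 0)
      fun x hx => by simpa using hx.1.2 a
  have hex : ∀ a, ∃ n : ℕ, y a = n := fun a => by
    obtain ⟨z, hz⟩ := hyint a
    have hz0 : 0 ≤ z := by exact_mod_cast hz ▸ hnn a
    exact ⟨z.toNat, by rw [hz]; exact_mod_cast (Int.toNat_of_nonneg hz0).symm⟩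
  choose n hn using hex
  obtain rfl : y = fun a => (n a : ℝ) := funext hn
  let σ : A → {v // D.IsSource v} := fun a => ⟨D.tail a, h.isSource_tail a⟩
  let τ : A → {v // D.IsSink v} := fun a => ⟨D.head a, h.isSink_head a⟩
  have hσ : ∀ u, (Finset.univ.filter fun a => σ a = u) = D.outArcs {u.1} := fun u => by
    rw [outArcs_singleton_of_isSource u.2]
    simp [σ, Subtype.ext_iff]
  have hτ : ∀ v, (Finset.univ.filter fun a => τ a = v) = D.outArcs {v.1}ᶜ := fun v => by
    rw [outArcs_compl_of_isSink v.2]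
    simp [τ, Subtype.ext_iff]
  classical
  obtain ⟨p, hp, hpi⟩ := exists_spanning_decomposition σ τ k n
    (fun v => by
      rw [hτ]
      have := sum_eq_of_mem_multipleOf hy (J := D.outArcs {v.1}ᶜ) (b := 1)
        fun x hx => hx.2 _ (h.compl_sink_mem v.1 v.2)
      rw [mul_one] at this
      exact_mod_cast this)
    (fun u => by
      rw [hσ]
      have := le_sum_of_mem_multipleOf hy (J := D.outArcs {u.1}) (b := 1)
        fun x hx => hx.1.1 _ (h.isDicut_singleton u.2)
      rw [mul_one] at this
      exact_mod_cast this)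
  refine ⟨fun i a => p i a, fun i => ⟨?_, fun a => ⟨p i a, by simp⟩⟩, ?_⟩
  · beta_reduce
    refine h.mem_dijFace (fun a => Nat.cast_nonneg _) (fun a ha => ?_) (fun v hv => ?_)
      (fun u hu => ?_) fun u hu hut => ?_
    · have h0 := sum_eq_of_mem_multipleOf hy (J := {a}) (b := 0) (by simpa using ha)
      have h1 : n a = 0 := by simpa using h0
      rw [hp, Finset.sum_eq_zero_iff] at h1
      exact_mod_cast h1 i (Finset.mem_univ i)
    · have := (hpi i).1 ⟨v, hv⟩
      rw [hτ] at this
      exact_mod_cast this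
    · have := (hpi i).2 ⟨u, hu⟩
      rw [hσ] at this
      exact_mod_cast this
    · have h0 := sum_eq_of_mem_multipleOf hy hut
      rw [mul_one] at h0
      -- At a tight source the `k` summand degrees, each at least one, have sum `k`.
      have h1 : ∑ i, ∑ a ∈ D.outArcs {u}, p i a = ∑ _i : Fin k, 1 := by
        rw [Finset.sum_comm, ← Finset.sum_congr rfl fun a _ => hp a]
        simpa using (by exact_mod_cast h0 : ∑ a ∈ D.outArcs {u}, n a = k)
      have h2 : ∀ i ∈ Finset.univ, 1 ≤ ∑ a ∈ D.outArcs {u}, p i a := fun i _ => by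
        have := (hpi i).2 ⟨u, hu⟩
        rwa [hσ] at this
      have h3 := (Finset.sum_eq_sum_iff_of_le h2).1 h1.symm i (Finset.mem_univ i)
      exact_mod_cast h3.symm
  · ext a
    rw [Finset.sum_apply, hp a]
    push_cast
    rfl

/-! ### The affine hull. -/

theorem IsDigraft.affineSpan_dijFace (h : D.IsDigraft F) :
    (affineSpan ℝ (D.dijFace F) : Set (A → ℝ)) =
      {x | ∀ i ∈ D.tightIndex F, D.dijForm i x = dijBound i} := by
  classical
  have hP := dijFace_eq_polyhedron (D := D) (F := F) fun U hU => h.isDicut hU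
  have hne := h.dijFace_nonempty
  -- Once the tight inequalities are kept only as equations, the remaining ones have a common strict
  -- point.
  have hP' : D.dijFace F = polyhedron D.dijForm dijBound
      (D.dijIndex.filter fun i => i ∉ D.tightIndex F) (D.tightIndex F) := by
    rw [hP]
    refine Set.Subset.antisymm
      (fun x hx => ⟨fun i hi => hx.1 i (Finset.mem_of_mem_filter i hi), hx.2⟩)
      fun x hx => ⟨fun i hi => ?_, hx.2⟩
    by_cases hit : i ∈ D.tightIndex F
    · exact (hx.2 i hit).ge
    · exact hx.1 i (Finset.mem_filter.2 ⟨hi, hit⟩)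
  rw [hP'] at hne
  obtain ⟨z, hz, hzs⟩ := exists_mem_polyhedron_forall_lt hne _ (fun i hi => by
    obtain ⟨hi1, hi2⟩ := Finset.mem_filter.1 hi
    by_contra! hcon
    refine hi2 (mem_tightIndex.2 ⟨hi1, fun x hx => ?_⟩)
    rw [hP'] at hx
    exact le_antisymm (hcon x hx) (hx.1 i hi)) subset_rfl
  rw [hP']
  exact affineSpan_polyhedron hz hzs

theorem IsDigraft.exists_matrix_affineSpan_eq (h : D.IsDigraft F) :
    ∃ (m : ℕ) (M : Matrix (Fin m) A ℤ), 1 ≤ m ∧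
      (affineSpan ℝ (D.dijFace F) : Set (A → ℝ)) =
        {x | (M.map (Int.cast : ℤ → ℝ)).mulVec x = 1} := by
  classical
  obtain ⟨v, hv⟩ := h.exists_isSink
  have hv0 : Sum.inl {v}ᶜ ∈ D.tightIndex F := inl_mem_tightIndex.2
    ⟨h.isDicut (h.compl_sink_mem v hv), fun x hx => hx.2 _ (h.compl_sink_mem v hv)⟩
  -- Indices that are not tight repeat the equation of the sink `v` as filler; a tight arc
  -- contributes that equation plus `x a`.
  let row : Finset V ⊕ A → A → ℤ := fun i =>
    if i ∈ D.tightIndex F then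
      Sum.elim (fun U b => if b ∈ D.outArcs U then 1 else 0)
        (fun a b => (if b ∈ D.outArcs {v}ᶜ then 1 else 0) + if b = a then 1 else 0) i
    else fun b => if b ∈ D.outArcs {v}ᶜ then 1 else 0
  let e := Fintype.equivFin (Finset V ⊕ A)
  refine ⟨Fintype.card (Finset V ⊕ A), Matrix.of fun j => row (e.symm j),
    Fintype.card_pos_iff.2 ⟨Sum.inl ∅⟩, ?_⟩
  rw [h.affineSpan_dijFace]
  ext x
  have hmul : (((Matrix.of fun j => row (e.symm j)).map (Int.cast : ℤ → ℝ)).mulVec x = 1) ↔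
      ∀ i, ∑ a, (row i a : ℝ) * x a = 1 := by
    rw [funext_iff, e.symm.forall_congr_left]
    simp [Matrix.mulVec, dotProduct]
  rw [Set.mem_ofPred_eq, Set.mem_ofPred_eq, hmul, forall_mem_tightIndex_iff]
  constructor
  · rintro ⟨h1, h2⟩ i
    by_cases hi : i ∈ D.tightIndex F
    · rcases i with U | a
      · simpa [row, hi] using h1 U hi
      · simpa [row, hi, add_mul, Finset.sum_add_distrib, h2 a hi] using h1 _ hv0
    · simpa [row, hi] using h1 _ hv0
  · intro hall
    have h1 : ∀ U, Sum.inl U ∈ D.tightIndex F → ∑ a ∈ D.outArcs U, x a = 1 := fun U hU => by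
      simpa [row, hU] using hall (Sum.inl U)
    refine ⟨h1, fun a ha => ?_⟩
    have h2 := hall (Sum.inr a)
    simp only [row, ha, if_true, Sum.elim_inr, Int.cast_add, Int.cast_ite, Int.cast_one,
      Int.cast_zero, add_mul, Finset.sum_add_distrib, ite_mul, one_mul, zero_mul,
      Finset.sum_ite_mem, Finset.univ_inter, Finset.sum_ite_eq', Finset.mem_univ, h1 _ hv0] at h2
    linarith

end MultiDigraph

theorem theorem1p7 {V A : Type*} [Fintype V] [DecidableEq V] [Fintype A]
    (D : MultiDigraph V A) (F : Set (Finset V)) (hDF : D.IsBasicRobustDigraft F) :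
    HasIDP (D.dijFace F) ∧
      ∃ (m : ℕ) (M : Matrix (Fin m) A ℤ), 1 ≤ m ∧
        (affineSpan ℝ (D.dijFace F) : Set (A → ℝ)) =
          {x | (M.map (Int.cast : ℤ → ℝ)).mulVec x = 1} :=
  ⟨hDF.hasIDP, hDF.exists_matrix_affineSpan_eq⟩
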